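/- Let $\mathbb K$ be $\mathbb R$ or $\mathbb C$. For a nonzero Banach space $E$ over $\mathbb K$ let $B_E$ and $S_E$ be its closed unit ball and unit sphere. A slice of $B_E$ is a set $\{x\in B_E:\operatorname{Re}x^*(x)>\sup_{y\in B_E}\operatorname{Re}x^*(y)-\varepsilon\}$ with $x^*\in S_{E^*}$ and $\varepsilon>0$; a convex combination of slices of $B_E$ is a set $\sum_{i=1}^n\lambda_iS_i=\{\sum_{i=1}^n\lambda_ix_i: x_i\in S_i\}$ with $n\in\mathbb N$, $\lambda_i>0$, $\sum_{i=1}^n\lambda_i=1$ and slices $S_1,\dots,S_n$ of $B_E$. A (continuous) polynomial $P:E\to E$ is a finite sum of maps $x\mapsto M_k(x,\dots,x)$ with $M_k$ continuous and $k$-linear ($k\ge 0$); it is weakly compact if $P(B_E)$ is relatively weakly compact, and $\|P\|=\sup_{x\in B_E}\|P(x)\|$. The space $E$ is said to have - the polynomial Daugavet property if $\|\mathrm{Id}+P\|=1+\|P\|$ for every weakly compact polynomial $P:E\to E$; - the Daugavet property if $\|\mathrm{Id}+T\|=1+\|T\|$ for every rank-one bounded linear operator $T:E\to E$; - the restricted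 DSD2P if $\sup_{y\in C}\|x-y\|=2$ for every convex combination $C$ of slices of $B_E$ and every $x\in C\cap S_E$; - the DD2P if $\sup_{y\in W}\|x-y\|=2$ for every nonempty relatively weakly open subset $W$ of $B_E$ and every $x\in W\cap S_E$; - the DLD2P if $\sup_{y\in S}\|x-y\|=2$ for every slice $S$ of $B_E$ and every $x\in S\cap S_E$; - property (D) if $\|\mathrm{Id}-P\|=2$ for every rank-one bounded linear projection $P:E\to E$ with $\|P\|=1$. Let $L$ be a nonempty locally compact Hausdorff space and let $X\neq\{0\}$ be a Banach space over $\mathbb K$ that is locally uniformly rotund (LUR): $\|x_k-x\|\to0$ whenever $x\in X$ and $(x_k)$ is a sequence in $X$ with $\lim_k\|\tfrac12(x_k+x)\|=\lim_k\|x_k\|=\|x\|$. Let $C_0(L,X)$ be the space of continuous functions $L\to X$ vanishing at infinity, with the supremum norm. Then the following are equivalent: 1. $C_0(L,X)$ has the polynomial Daugavet property. 2. $C_0(L,X)$ has the Daugavet property. 3. $C_0(L,X)$ has the restricted DSD2P. 4. $C_0(L,X)$ has the DD2P. 5. $C_0(L,X)$ has the DLD2P. 6. $C_0(L,X)$ has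 property (D). 7. $L$ has no isolated points. -/

import Mathlib

open Filter Topology
open scoped ZeroAtInfty

noncomputable section

namespace DaugavetNotions

/-- Local uniform rotundity (LUR): `‖x_k - x‖ → 0` whenever `‖(x_k + x) / 2‖ → ‖x‖` and
`‖x_k‖ → ‖x‖`. -/
def IsLUR (𝕜 X : Type*) [RCLike 𝕜] [NormedAddCommGroup X] [NormedSpace 𝕜 X] : Prop :=
  ∀ (x : X) (u : ℕ → X),
    Tendsto (fun k => ‖(2⁻¹ : 𝕜) • (u k + x)‖) atTop (𝓝 ‖x‖) →
    Tendsto (fun k => ‖u k‖) atTop (𝓝 ‖x‖) →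
    Tendsto (fun k => ‖u k - x‖) atTop (𝓝 0)

section

variable (𝕜 : Type*) {E : Type*} [RCLike 𝕜] [NormedAddCommGroup E] [NormedSpace 𝕜 E]

/-- The set `{x ∈ A : re f x > sup_{y ∈ A} re f y - ε}`. -/
def slice {𝕜 : Type*} [RCLike 𝕜] [NormedSpace 𝕜 E] (A : Set E) (f : StrongDual 𝕜 E) (ε : ℝ) :
    Set E :=
  {x | x ∈ A ∧ sSup ((fun y => RCLike.re (f y)) '' A) - ε < RCLike.re (f x)}

/-- `S` is a slice of the closed unit ball, given by a norm-one functional and some `ε > 0`. -/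
def IsBallSlice (S : Set E) : Prop :=
  ∃ (f : StrongDual 𝕜 E) (ε : ℝ), ‖f‖ = 1 ∧ 0 < ε ∧ S = slice (Metric.closedBall (0 : E) 1) f ε

/-- `C` is a convex combination of slices of the closed unit ball. -/
def IsConvexCombinationOfSlices (C : Set E) : Prop :=
  ∃ (n : ℕ) (c : Fin n → ℝ) (S : Fin n → Set E),
    (∀ i, 0 < c i) ∧ ∑ i, c i = 1 ∧ (∀ i, IsBallSlice 𝕜 (S i)) ∧
    C = {x | x ∈ Metric.closedBall (0 : E) 1 ∧
      ∃ y : Fin n → E, (∀ i, y i ∈ S i) ∧ x = ∑ i, (c i : 𝕜) • y i}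

/-- `W` is a relatively weakly open subset of the closed unit ball. -/
def IsWeaklyOpenInBall (W : Set E) : Prop :=
  ∃ U : Set (WeakSpace 𝕜 E), IsOpen U ∧
    W = Metric.closedBall (0 : E) 1 ∩ toWeakSpace 𝕜 E ⁻¹' U

/-- `sup_{y ∈ A} ‖x - y‖ = 2`. -/
def SupDistEqTwo (x : E) (A : Set E) : Prop :=
  IsLUB ((fun y => ‖x - y‖) '' A) 2

/-- `P` is a continuous polynomial: a finite sum of continuous homogeneous polynomials
`x ↦ M k (x, …, x)`, with `M k` a continuous `k`-linear map. -/
def IsContinuousPolynomial (P : E → E) : Prop :=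
  ∃ (n : ℕ) (M : (k : ℕ) → ContinuousMultilinearMap 𝕜 (fun _ : Fin k => E) E),
    ∀ x, P x = ∑ k ∈ Finset.range (n + 1), M k (fun _ => x)

/-- `P` maps the closed unit ball to a relatively weakly compact set. -/
def IsWeaklyCompactMap (P : E → E) : Prop :=
  IsCompact (closure (toWeakSpace 𝕜 E '' (P '' Metric.closedBall (0 : E) 1)))

/-- The norm `sup_{‖x‖ ≤ 1} ‖P x‖`. -/
def ballSupNorm (P : E → E) : ℝ :=
  sSup ((fun x => ‖P x‖) '' Metric.closedBall (0 : E) 1)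

/-- The supremum defining the norm of a continuous polynomial is finite. -/
theorem IsContinuousPolynomial.bddAbove {P : E → E} (hP : IsContinuousPolynomial 𝕜 P) :
    BddAbove ((fun x => ‖P x‖) '' Metric.closedBall (0 : E) 1) := by
  obtain ⟨n, M, hM⟩ := hP
  refine ⟨∑ k ∈ Finset.range (n + 1), ‖M k‖, ?_⟩
  rintro _ ⟨x, hx, rfl⟩
  have hx' : ‖x‖ ≤ 1 := by simpa using hx
  simp only [hM]
  refine (norm_sum_le _ _).trans (Finset.sum_le_sum fun k _ => ?_)
  refine ((M k).le_opNorm _).trans ?_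
  refine mul_le_of_le_one_right (norm_nonneg _) ?_
  exact Finset.prod_le_one (fun _ _ => norm_nonneg _) (fun _ _ => hx')

end

section

variable (𝕜 E : Type*) [RCLike 𝕜] [NormedAddCommGroup E] [NormedSpace 𝕜 E]

/-- Every weakly compact polynomial satisfies `‖Id + P‖ = 1 + ‖P‖`. -/
def PolynomialDaugavetProperty : Prop :=
  ∀ P : E → E, IsContinuousPolynomial 𝕜 P → IsWeaklyCompactMap 𝕜 P →
    ballSupNorm (fun x => x + P x) = 1 + ballSupNorm P

/-- Every rank-one bounded operator satisfies `‖Id + T‖ = 1 + ‖T‖`. -/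
def DaugavetProperty : Prop :=
  ∀ T : E →L[𝕜] E, LinearMap.rank (T : E →ₗ[𝕜] E) = 1 →
    ‖ContinuousLinearMap.id 𝕜 E + T‖ = 1 + ‖T‖

/-- The restricted diametral strong diameter two property. -/
def RestrictedDSD2P : Prop :=
  ∀ C : Set E, IsConvexCombinationOfSlices 𝕜 C →
    ∀ x ∈ C ∩ Metric.sphere (0 : E) 1, SupDistEqTwo x C

/-- The diametral diameter two property. -/
def DD2P : Prop :=
  ∀ W : Set E, W.Nonempty → IsWeaklyOpenInBall 𝕜 W →
    ∀ x ∈ W ∩ Metric.sphere (0 : E) 1, SupDistEqTwo x W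

/-- The diametral local diameter two property. -/
def DLD2P : Prop :=
  ∀ S : Set E, IsBallSlice 𝕜 S →
    ∀ x ∈ S ∩ Metric.sphere (0 : E) 1, SupDistEqTwo x S

/-- Property (D): every rank-one norm-one projection satisfies `‖I - P‖ = 2`. -/
def PropertyD : Prop :=
  ∀ P : E →L[𝕜] E, P.comp P = P → LinearMap.rank (P : E →ₗ[𝕜] E) = 1 → ‖P‖ = 1 →
    ‖ContinuousLinearMap.id 𝕜 E - P‖ = 2

end

end DaugavetNotions

end

/-! Suppose `L` has no isolated points. Every nonempty open set then carries infinitely many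
disjoint bumps, and pushing `f` towards a fixed vector `v` on the `j`-th bump is a perturbation `h
j` whose finite sums are uniformly bounded. Continuous multilinear forms are sequentially continuous
along such perturbations (`tendsto_re_map_piecewise_add`), so `f + h j` tends weakly to `f` although
it takes the value `v` at some point of the open set. Taking for `v` the negative of an almost
maximal value of `f` moves `f` by almost 2 inside any weakly open set, which gives the diametral
properties. For a polynomial, `P (f + h j)` also tends weakly to `P f`; weak compactness and a
double limit argument (`exists_apply_eq_and_le_re`) then give `g` and `t` with `g t = v` and `P g t`
almost as large as possible in the direction normed by `v`.

Conversely, each property implies property (D), in any normed space. At an isolated point `t`, a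
norming pair in `X` yields a rank-one projection concentrated at `t` that violates (D), by
`IsLUR.exists_norm_sub_smul_le`. This is the only use of rotundity. -/

noncomputable section

namespace DaugavetNotions

/-! ### Polynomials and weak convergence along sequences with bounded finite sums. -/

section Normed

variable {𝕜 E : Type*} [RCLike 𝕜] [NormedAddCommGroup E] [NormedSpace 𝕜 E]

/-- The increment in `z` involves `z` in strictly fewer slots than `s`; this is what drives the
induction on `s` below. -/
theorem map_piecewise_add_eq_add_sum_ssubsets {ι : Type*} [Fintype ι] [DecidableEq ι]
    (M : ContinuousMultilinearMap 𝕜 (fun _ : ι => E) 𝕜) (s : Finset ι) (b : ι → E) (z y : E) :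
    M (s.piecewise (fun _ => z + y) b) = M (s.piecewise (fun _ => z) b) +
      ∑ r ∈ s.ssubsets, M (r.piecewise (fun _ => z) (s.piecewise (fun _ => y) b)) := by
  have h := M.map_piecewise_add (fun _ => z) (s.piecewise (fun _ => y) b) s
  have h1 : s.piecewise ((fun _ => z) + s.piecewise (fun _ => y) b) (s.piecewise (fun _ => y) b)
      = s.piecewise (fun _ => z + y) b := by
    ext i
    by_cases hi : i ∈ s <;> simp [hi]
  have h2 : s.piecewise (fun _ => z) (s.piecewise (fun _ => y) b)
      = s.piecewise (fun _ => z) b := by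
    ext i
    by_cases hi : i ∈ s <;> simp [hi]
  rw [h1] at h
  rw [h, Finset.ssubsets, ← h2,
    Finset.add_sum_erase _ (fun r => M (r.piecewise (fun _ => z) (s.piecewise (fun _ => y) b)))
      (Finset.mem_powerset_self s)]

theorem exists_norm_map_piecewise_le {ι : Type*} [Fintype ι] [DecidableEq ι]
    (M : ContinuousMultilinearMap 𝕜 (fun _ : ι => E) 𝕜) (s : Finset ι) (b : ι → E) (R : ℝ) :
    ∃ K : ℝ, ∀ z : E, ‖z‖ ≤ R → ‖M (s.piecewise (fun _ => z) b)‖ ≤ K := by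
  refine ⟨‖M‖ * ∏ i, (R + ‖b i‖), fun z hz => ?_⟩
  have hR : 0 ≤ R := (norm_nonneg z).trans hz
  refine (M.le_opNorm _).trans (mul_le_mul_of_nonneg_left ?_ (norm_nonneg _))
  refine Finset.prod_le_prod (fun _ _ => norm_nonneg _) fun i _ => ?_
  by_cases hi : i ∈ s
  · simpa [hi] using hz.trans (le_add_of_nonneg_right (norm_nonneg _))
  · simpa [hi] using hR

/-- Continuous multilinear forms are sequentially continuous along sequences whose finite partial
sums are uniformly bounded. -/
theorem tendsto_re_map_piecewise_add {ι : Type*} [Fintype ι] [DecidableEq ι] {h : ℕ → E} {C : ℝ}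
    (hC : ∀ F : Finset ℕ, ‖∑ j ∈ F, h j‖ ≤ C) (x : E) (s : Finset ι) :
    ∀ (M : ContinuousMultilinearMap 𝕜 (fun _ : ι => E) 𝕜) (b : ι → E),
      Tendsto (fun j => RCLike.re (M (s.piecewise (fun _ => x + h j) b))) atTop
        (𝓝 (RCLike.re (M (s.piecewise (fun _ => x) b)))) := by
  induction s using Finset.strongInduction with
  | H s ih =>
  -- An upper estimate suffices: applied to `-M` it gives the lower one.
  have key : ∀ (M : ContinuousMultilinearMap 𝕜 (fun _ : ι => E) 𝕜) (b : ι → E) (δ : ℝ), 0 < δ →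
      ∀ᶠ j in atTop, RCLike.re (M (s.piecewise (fun _ => x + h j) b)) <
        RCLike.re (M (s.piecewise (fun _ => x) b)) + δ := by
    intro M b δ hδ
    by_contra hcon
    set A : E → ℝ := fun z => RCLike.re (M (s.piecewise (fun _ => z) b)) with hA
    have hfreq : ∃ᶠ j in atTop, A x + δ ≤ A (x + h j) := by
      simpa [Filter.Frequently, not_le] using hcon
    -- The increment by `y` is a sum over proper subsets of `s`, to which the induction hypothesis
    -- applies.
    have hdiff : ∀ y : E, Tendsto (fun j => A (x + h j + y) - A (x + h j)) atTop
        (𝓝 (A (x + y) - A x)) := by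
      intro y
      have hform : ∀ z : E, A (z + y) - A z = ∑ r ∈ s.ssubsets,
          RCLike.re (M (r.piecewise (fun _ => z) (s.piecewise (fun _ => y) b))) := by
        intro z
        simp only [hA, map_piecewise_add_eq_add_sum_ssubsets M s b z y, map_add, map_sum]
        ring
      simp only [hform]
      exact tendsto_finsetSum _ fun r hr => ih r (Finset.mem_ssubsets.1 hr) M _
    -- By `hdiff`, a late `h j` that gains `δ` at `x` still gains at least `δ / 2` at `x + ∑ j ∈ F,
    -- h j`. Iterating makes `A` unbounded on a bounded set.
    have hgreedy : ∀ n : ℕ, ∃ F : Finset ℕ, A x + n * (δ / 2) ≤ A (x + ∑ j ∈ F, h j) := by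
      intro n
      induction n with
      | zero => exact ⟨∅, by simp⟩
      | succ n ihn =>
        obtain ⟨F, hF⟩ := ihn
        have h1 := (hdiff (∑ j ∈ F, h j)).eventually
          (lt_mem_nhds (sub_lt_self _ (half_pos hδ)))
        have h2 : ∀ᶠ j in atTop, j ∉ F := by
          obtain ⟨N, hN⟩ := F.exists_nat_subset_range
          filter_upwards [eventually_ge_atTop N] with j hj hjF
          exact absurd (Finset.mem_range.1 (hN hjF)) (not_lt.2 hj)
        obtain ⟨j, hj, hj1, hj2⟩ := (hfreq.and_eventually (h1.and h2)).exists
        refine ⟨insert j F, ?_⟩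
        rw [Finset.sum_insert hj2, ← add_assoc]
        push_cast
        linarith
    obtain ⟨K, hK⟩ := exists_norm_map_piecewise_le M s b (‖x‖ + C)
    obtain ⟨n, hn⟩ := exists_nat_gt ((K - A x) / (δ / 2))
    obtain ⟨F, hF⟩ := hgreedy n
    have h1 : A (x + ∑ j ∈ F, h j) ≤ K :=
      (RCLike.re_le_norm _).trans (hK _ ((norm_add_le _ _).trans (by linarith [hC F])))
    rw [div_lt_iff₀ (half_pos hδ)] at hn
    linarith
  intro M b
  refine tendsto_order.2 ⟨fun a ha => ?_, fun a ha => ?_⟩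
  · filter_upwards [key (-M) b _ (sub_pos.2 ha)] with j hj
    simp only [neg_apply, map_neg] at hj
    linarith
  · filter_upwards [key M b _ (sub_pos.2 ha)] with j hj
    linarith

theorem IsContinuousPolynomial.tendsto_re_add {P : E → E} (hP : IsContinuousPolynomial 𝕜 P)
    {h : ℕ → E} {C : ℝ} (hC : ∀ F : Finset ℕ, ‖∑ j ∈ F, h j‖ ≤ C) (x : E)
    (φ : StrongDual 𝕜 E) :
    Tendsto (fun j => RCLike.re (φ (P (x + h j)))) atTop (𝓝 (RCLike.re (φ (P x)))) := by
  obtain ⟨n, M, hM⟩ := hP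
  simp only [hM, map_sum]
  refine tendsto_finsetSum _ fun k _ => ?_
  simpa using tendsto_re_map_piecewise_add hC x Finset.univ
    (φ.compContinuousMultilinearMap (M k)) 0

/-- This is the case of one slot; testing with `-I • φ` as well recovers the imaginary parts. -/
theorem tendsto_toWeakSpace_add {h : ℕ → E} {C : ℝ} (hC : ∀ F : Finset ℕ, ‖∑ j ∈ F, h j‖ ≤ C)
    (x : E) :
    Tendsto (fun j => toWeakSpace 𝕜 E (x + h j)) atTop (𝓝 (toWeakSpace 𝕜 E x)) := by
  have hre : ∀ φ : StrongDual 𝕜 E,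
      Tendsto (fun j => RCLike.re (φ (x + h j))) atTop (𝓝 (RCLike.re (φ x))) := fun φ => by
    simpa using tendsto_re_map_piecewise_add hC x Finset.univ
      (φ.compContinuousMultilinearMap
        (ContinuousMultilinearMap.ofSubsingleton 𝕜 E E (0 : Fin 1) (.id 𝕜 E))) 0
  have hinj : Function.Injective (topDualPairing 𝕜 E).flip := fun a c hac => by
    by_contra hne
    obtain ⟨f, hf⟩ := SeparatingDual.exists_separating_of_ne (R := 𝕜) hne
    exact hf (LinearMap.congr_fun hac f)
  refine (WeakBilin.tendsto_iff_forall_eval_tendsto _ hinj).2 fun φ => ?_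
  change Tendsto (fun j => φ (x + h j)) atTop (𝓝 (φ x))
  have him := hre (-(RCLike.I : 𝕜) • φ)
  have hboth := ((RCLike.continuous_ofReal (K := 𝕜)).continuousAt.tendsto.comp (hre φ)).add
    (((RCLike.continuous_ofReal (K := 𝕜)).continuousAt.tendsto.comp him).mul_const RCLike.I)
  have hz : ∀ z : 𝕜, (RCLike.re z : 𝕜) + (RCLike.re (-(RCLike.I : 𝕜) * z) : 𝕜) * RCLike.I = z :=
    fun z => by
      have h1 : RCLike.re (-(RCLike.I : 𝕜) * z) = RCLike.im z := by
        simp [RCLike.mul_re, mul_comm, RCLike.I_im]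
      rw [h1, RCLike.re_add_im]
  simpa only [Function.comp_def, smul_apply, smul_eq_mul, hz] using hboth

theorem continuous_re_weakSpace (φ : StrongDual 𝕜 E) :
    Continuous fun w : WeakSpace 𝕜 E => RCLike.re (φ ((toWeakSpace 𝕜 E).symm w)) :=
  RCLike.continuous_re.comp (WeakBilin.eval_continuous (topDualPairing 𝕜 E).flip φ)

theorem IsBallSlice.isWeaklyOpenInBall {S : Set E} (hS : IsBallSlice 𝕜 S) :
    IsWeaklyOpenInBall 𝕜 S := by
  obtain ⟨f, ε, -, -, rfl⟩ := hS
  exact ⟨_, isOpen_lt continuous_const (continuous_re_weakSpace f), rfl⟩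

theorem IsWeaklyOpenInBall.eventually_mem {W : Set E} (hW : IsWeaklyOpenInBall 𝕜 W) {x : E}
    (hx : x ∈ W) {h : ℕ → E} {C : ℝ} (hC : ∀ F : Finset ℕ, ‖∑ j ∈ F, h j‖ ≤ C)
    (hball : ∀ j, ‖x + h j‖ ≤ 1) : ∀ᶠ j in atTop, x + h j ∈ W := by
  obtain ⟨U, hU, rfl⟩ := hW
  filter_upwards [(tendsto_toWeakSpace_add (𝕜 := 𝕜) hC x).eventually (hU.mem_nhds hx.2)] with j hj
  exact ⟨by simpa using hball j, hj⟩

theorem supDistEqTwo_of_forall_exists {x : E} {A : Set E} (hx : ‖x‖ ≤ 1)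
    (hA : ∀ y ∈ A, ‖y‖ ≤ 1) (h : ∀ ε : ℝ, 0 < ε → ∃ y ∈ A, 2 - ε ≤ ‖x - y‖) :
    SupDistEqTwo x A := by
  refine ⟨?_, fun c hc => le_of_forall_pos_sub_le fun ε hε => ?_⟩
  · rintro _ ⟨y, hy, rfl⟩
    exact (norm_sub_le _ _).trans (by linarith [hA y hy])
  · obtain ⟨y, hy, hxy⟩ := h ε hε
    exact hxy.trans (hc ⟨y, hy, rfl⟩)

theorem SupDistEqTwo.exists_lt {x : E} {A : Set E} (h : SupDistEqTwo x A) {ε : ℝ} (hε : 0 < ε) :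
    ∃ y ∈ A, 2 - ε < ‖x - y‖ := by
  obtain ⟨_, ⟨y, hy, rfl⟩, hlt, -⟩ := h.exists_between (sub_lt_self 2 hε)
  exact ⟨y, hy, hlt⟩

/-! ### Implications valid in every normed space. -/

theorem RestrictedDSD2P.dld2p (h : RestrictedDSD2P 𝕜 E) : DLD2P 𝕜 E := by
  intro S hS
  refine h S ⟨1, fun _ => 1, fun _ => S, by simp, by simp, fun _ => hS, ?_⟩
  obtain ⟨f, ε, -, -, rfl⟩ := hS
  ext x
  refine ⟨fun hx => ⟨hx.1, fun _ => x, fun _ => hx, by simp⟩, ?_⟩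
  rintro ⟨-, y, hy, rfl⟩
  simpa using hy 0

theorem DD2P.dld2p (h : DD2P 𝕜 E) : DLD2P 𝕜 E :=
  fun S hS x hx => h S ⟨x, hx.1⟩ hS.isWeaklyOpenInBall x hx

theorem DaugavetProperty.propertyD (h : DaugavetProperty 𝕜 E) : PropertyD 𝕜 E := by
  intro P _ hrank hnorm
  have := h (-P) (by
    rw [← hrank, LinearMap.rank, LinearMap.rank]
    have : LinearMap.range ((-P : E →L[𝕜] E) : E →ₗ[𝕜] E)
        = LinearMap.range (P : E →ₗ[𝕜] E) := LinearMap.range_neg _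
    rw [this])
  rw [sub_eq_add_neg, this, norm_neg, hnorm]
  norm_num

theorem one_mem_upperBounds_re_image_ball (f : StrongDual 𝕜 E) (hf : ‖f‖ ≤ 1) :
    1 ∈ upperBounds ((fun y => RCLike.re (f y)) '' Metric.closedBall (0 : E) 1) := by
  rintro _ ⟨y, hy, rfl⟩
  have hy' : ‖y‖ ≤ 1 := by simpa using hy
  exact (RCLike.re_le_norm _).trans ((f.le_of_opNorm_le_of_le hf hy').trans (by simp))

theorem norm_one_sub_sq_le {z : 𝕜} (hz : ‖z‖ ≤ 1) : ‖1 - z‖ ^ 2 ≤ 2 * (1 - RCLike.re z) := by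
  have h1 : ‖z‖ ^ 2 ≤ 1 := pow_le_one₀ (norm_nonneg _) hz
  rw [← RCLike.normSq_eq_def', RCLike.normSq_apply] at h1 ⊢
  simp only [map_sub, RCLike.one_re, RCLike.one_im]
  nlinarith

/-- A rank-one projection of norm one is `y ↦ f y • x` with `‖x‖ = ‖f‖ = f x = 1`. -/
theorem exists_eq_smul_of_projection {P : E →L[𝕜] E} (hP : P.comp P = P)
    (hrank : LinearMap.rank (P : E →ₗ[𝕜] E) = 1) (hnorm : ‖P‖ = 1) :
    ∃ (f : StrongDual 𝕜 E) (x : E), ‖x‖ = 1 ∧ ‖f‖ = 1 ∧ f x = 1 ∧ ∀ y, P y = f y • x := by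
  obtain ⟨x₀, hx₀, hne, hspan⟩ := (rank_submodule_eq_one_iff _).1 hrank
  have hpos : ‖x₀‖ ≠ 0 := norm_ne_zero_iff.2 hne
  obtain ⟨x, hx, c, hc⟩ : ∃ x : E, ‖x‖ = 1 ∧ ∃ c : 𝕜, x₀ = c • x :=
    ⟨((‖x₀‖⁻¹ : ℝ) : 𝕜) • x₀, by rw [norm_smul]; simp [hpos], (‖x₀‖ : 𝕜), by
      rw [smul_smul, ← RCLike.ofReal_mul, mul_inv_cancel₀ hpos]; simp⟩
  have hc0 : c ≠ 0 := by rintro rfl; simp at hc; exact hne hc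
  have hxP : P x = x := by
    obtain ⟨w, hw⟩ := hx₀
    have h1 : P x₀ = x₀ := by
      rw [← hw]
      exact DFunLike.congr_fun hP w
    rw [hc, map_smul] at h1
    exact smul_right_injective E hc0 h1
  have hP' : ∀ y, ∃ a : 𝕜, P y = a • x := fun y => by
    obtain ⟨a, ha⟩ := Submodule.mem_span_singleton.1 (hspan (LinearMap.mem_range_self _ y))
    exact ⟨a * c, by rw [mul_smul, ← hc, ha]; rfl⟩
  obtain ⟨g, hg, hgx⟩ := exists_dual_vector 𝕜 x (by simp [hx])
  have hgx' : g x = 1 := by simp [hgx, hx]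
  have hfx : (g.comp P) x = 1 := by simp [hxP, hgx']
  refine ⟨g.comp P, x, hx, le_antisymm ?_ ?_, hfx, fun y => ?_⟩
  · simpa [hg, hnorm] using g.opNorm_comp_le P
  · simpa [hfx, hx] using (g.comp P).le_opNorm x
  · obtain ⟨a, ha⟩ := hP' y
    simp [ha, hgx']

/-- Write `P = f ⊗ x` with `f x = 1`. A point `y` of a thin slice of `f` has `P y` close to `x`, so
if `y` is almost at distance 2 from `x`, then `y - P y` has norm almost 2. -/
theorem DLD2P.propertyD (h : DLD2P 𝕜 E) : PropertyD 𝕜 E := by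
  intro P hP hrank hnorm
  obtain ⟨f, x, hx, hf, hfx, hPf⟩ := exists_eq_smul_of_projection hP hrank hnorm
  refine le_antisymm ?_ (le_of_forall_pos_sub_le fun ε hε => ?_)
  · refine (norm_sub_le _ _).trans ?_
    linarith [ContinuousLinearMap.norm_id_le (𝕜 := 𝕜) (E := E)]
  -- The bound `ε ^ 2 / 8` turns `‖1 - f y‖ ^ 2 ≤ 2 * δ` into `‖1 - f y‖ ≤ ε / 2`.
  set δ : ℝ := min (ε / 2) (ε ^ 2 / 8) with hδ
  have hδ0 : 0 < δ := by positivity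
  have hub := one_mem_upperBounds_re_image_ball f hf.le
  have hxball : x ∈ Metric.closedBall (0 : E) 1 := by simp [hx]
  have hsup : sSup ((fun y => RCLike.re (f y)) '' Metric.closedBall (0 : E) 1) = 1 :=
    le_antisymm (csSup_le ⟨_, x, hxball, rfl⟩ hub) (le_csSup ⟨1, hub⟩ ⟨x, hxball, by simp [hfx]⟩)
  obtain ⟨y, ⟨hy, hfy⟩, hxy⟩ := (h _ ⟨f, δ, hf, hδ0, rfl⟩ x
    ⟨⟨hxball, by rw [hsup, hfx]; simp [hδ0]⟩, by simp [hx]⟩).exists_lt (half_pos hε)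
  rw [hsup] at hfy
  have hy1 : ‖y‖ ≤ 1 := by simpa using hy
  have hfy1 : ‖f y‖ ≤ 1 := (f.le_of_opNorm_le_of_le hf.le hy1).trans (by simp)
  have hdist : ‖1 - f y‖ ≤ ε / 2 := by
    refine abs_le_of_sq_le_sq' ?_ (by positivity) |>.2
    have := norm_one_sub_sq_le hfy1
    have := min_le_right (ε / 2) (ε ^ 2 / 8)
    nlinarith
  have hle := (ContinuousLinearMap.id 𝕜 E - P).le_of_opNorm_le_of_le le_rfl hy1
  have heq : x - y = (1 - f y) • x - (ContinuousLinearMap.id 𝕜 E - P) y := by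
    simp [hPf, sub_smul]
  have h3 : ‖x - y‖ ≤ ‖1 - f y‖ + ‖(ContinuousLinearMap.id 𝕜 E - P) y‖ := by
    rw [heq]
    refine (norm_sub_le _ _).trans ?_
    rw [norm_smul, hx, mul_one]
  linarith

theorem ballSupNorm_eq_norm (T : E →L[𝕜] E) : ballSupNorm (fun x => T x) = ‖T‖ :=
  T.sSup_unitClosedBall_eq_norm

theorem isContinuousPolynomial_continuousLinearMap (T : E →L[𝕜] E) :
    IsContinuousPolynomial 𝕜 (fun x => T x) := by
  refine ⟨1, fun k => if h : k = 1 then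
    h ▸ ContinuousMultilinearMap.ofSubsingleton 𝕜 E E (0 : Fin 1) T else 0, fun x => ?_⟩
  simp [Finset.sum_range_succ]

/-- The image of the ball lies in a norm-compact ball of the finite-dimensional range, which is
weakly compact too. -/
theorem isWeaklyCompactMap_of_rank_eq_one (T : E →L[𝕜] E)
    (hT : LinearMap.rank (T : E →ₗ[𝕜] E) = 1) : IsWeaklyCompactMap 𝕜 (fun x => T x) := by
  set R := LinearMap.range (T : E →ₗ[𝕜] E)
  have hfin : FiniteDimensional 𝕜 R := Module.finite_of_rank_eq_one hT
  have : ProperSpace R := FiniteDimensional.proper_rclike 𝕜 R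
  have hK : IsCompact (toWeakSpace 𝕜 E '' (Subtype.val '' Metric.closedBall (0 : R) ‖T‖)) :=
    ((isCompact_closedBall _ _).image continuous_subtype_val).image (toWeakSpaceCLM 𝕜 E).cont
  refine hK.closure_of_subset (Set.image_mono ?_)
  rintro _ ⟨x, hx, rfl⟩
  have hx' : ‖x‖ ≤ 1 := by simpa using hx
  refine ⟨⟨T x, x, rfl⟩, ?_, rfl⟩
  simpa using T.le_of_opNorm_le_of_le le_rfl hx'

theorem PolynomialDaugavetProperty.daugavetProperty (h : PolynomialDaugavetProperty 𝕜 E) :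
    DaugavetProperty 𝕜 E := by
  intro T hT
  have := h _ (isContinuousPolynomial_continuousLinearMap T)
    (isWeaklyCompactMap_of_rank_eq_one T hT)
  rw [ballSupNorm_eq_norm] at this
  rw [← this, ← ballSupNorm_eq_norm]
  rfl

end Normed

theorem exists_dual_vector_and_peak (𝕜 : Type*) {X : Type*} [RCLike 𝕜] [NormedAddCommGroup X]
    [NormedSpace 𝕜 X] [Nontrivial X] (z : X) :
    ∃ (φ : StrongDual 𝕜 X) (v : X), ‖φ‖ = 1 ∧ ‖v‖ = 1 ∧ φ v = 1 ∧ φ z = ‖z‖ := by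
  obtain ⟨w, hw, hwz⟩ : ∃ w : X, w ≠ 0 ∧ (z = 0 ∨ z = w) := by
    by_cases hz : z = 0
    · obtain ⟨w, hw⟩ := exists_ne (0 : X)
      exact ⟨w, hw, .inl hz⟩
    · exact ⟨z, hz, .inr rfl⟩
  have hw' : ‖w‖ ≠ 0 := norm_ne_zero_iff.2 hw
  obtain ⟨φ, hφ, hφw⟩ := exists_dual_vector 𝕜 w hw'
  refine ⟨φ, ((‖w‖⁻¹ : ℝ) : 𝕜) • w, hφ, by simp [norm_smul, hw'], ?_, ?_⟩
  · rw [map_smul, hφw, smul_eq_mul, ← RCLike.ofReal_mul, inv_mul_cancel₀ hw', RCLike.ofReal_one]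
  · rcases hwz with rfl | rfl
    · simp
    · exact hφw

/-! ### Bump perturbations in `C₀(L, X)`. -/

section ZeroAtInfty

variable {𝕜 L X : Type*} [RCLike 𝕜] [TopologicalSpace L] [NormedAddCommGroup X] [NormedSpace 𝕜 X]

theorem norm_apply_le_norm (f : C₀(L, X)) (t : L) : ‖f t‖ ≤ ‖f‖ :=
  f.toBCF.norm_coe_le_norm t

theorem norm_le_of_forall_apply_le (f : C₀(L, X)) {c : ℝ} (hc : 0 ≤ c) (h : ∀ t, ‖f t‖ ≤ c) :
    ‖f‖ ≤ c :=
  (BoundedContinuousFunction.norm_le (f := f.toBCF) hc).2 h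

theorem exists_lt_norm_apply [Nonempty L] (f : C₀(L, X)) {c : ℝ} (hc : c < ‖f‖) :
    ∃ t, c < ‖f t‖ := by
  by_contra! h
  have hc0 : 0 ≤ c := (norm_nonneg _).trans (h (Classical.arbitrary L))
  exact absurd (norm_le_of_forall_apply_le f hc0 h) (not_le.2 hc)

variable (𝕜 X) in
/-- Evaluation at a point, as a continuous linear map. -/
def evalAt (t : L) : C₀(L, X) →L[𝕜] X :=
  LinearMap.mkContinuous ⟨⟨fun f => f t, fun _ _ => rfl⟩, fun _ _ => rfl⟩ 1 fun f => by
    simpa using norm_apply_le_norm f t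

@[simp]
theorem evalAt_apply (t : L) (f : C₀(L, X)) : evalAt 𝕜 X t f = f t := rfl

theorem sum_apply {ι : Type*} (F : Finset ι) (h : ι → C₀(L, X)) (t : L) :
    (∑ j ∈ F, h j) t = ∑ j ∈ F, h j t := by
  classical
  induction F using Finset.induction_on with
  | empty => simp
  | insert a s ha ih => simp [Finset.sum_insert ha, ih]

variable (𝕜) in
/-- The function `t ↦ u t • (v - f t)`: adding it to `f` moves `f` towards the constant `v` at the
rate given by the cutoff function `u`. -/
def bumpTowards (u : C(L, ℝ)) (hu : HasCompactSupport u) (v : X) (f : C₀(L, X)) : C₀(L, X) where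
  toFun t := (u t : 𝕜) • (v - f t)
  continuous_toFun := by
    have := f.continuous
    exact (RCLike.continuous_ofReal.comp u.continuous).smul (continuous_const.sub this)
  zero_at_infty' := by
    refine HasCompactSupport.is_zero_at_infty (f := fun t => (u t : 𝕜) • (v - f t)) ?_
    exact (hu.comp_left (g := fun r : ℝ => (r : 𝕜)) (by simp)).smul_right

@[simp]
theorem bumpTowards_apply (u : C(L, ℝ)) (hu : HasCompactSupport u) (v : X) (f : C₀(L, X)) (t : L) :
    bumpTowards 𝕜 u hu v f t = (u t : 𝕜) • (v - f t) := rfl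

/-- Pointwise, the perturbed function is a convex combination of `f t` and `v`. -/
theorem norm_add_bumpTowards_le {u : C(L, ℝ)} (hu : HasCompactSupport u)
    (h01 : ∀ t, u t ∈ Set.Icc (0 : ℝ) 1) {v : X} {f : C₀(L, X)} (hv : ‖v‖ ≤ 1) (hf : ‖f‖ ≤ 1) :
    ‖f + bumpTowards 𝕜 u hu v f‖ ≤ 1 := by
  refine norm_le_of_forall_apply_le _ zero_le_one fun t => ?_
  have hft := (norm_apply_le_norm f t).trans hf
  have heq : (f + bumpTowards 𝕜 u hu v f) t = ((1 - u t : ℝ) : 𝕜) • f t + (u t : 𝕜) • v := by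
    simp only [ZeroAtInftyContinuousMap.add_apply, bumpTowards_apply, RCLike.ofReal_sub,
      RCLike.ofReal_one]
    module
  have h0 := (h01 t).1
  have h1 := sub_nonneg.2 (h01 t).2
  rw [heq]
  refine (norm_add_le _ _).trans ?_
  rw [norm_smul, norm_smul, RCLike.norm_of_nonneg h0, RCLike.norm_of_nonneg h1]
  nlinarith

/-- A sequence of compactly supported cutoff functions with disjoint supports. -/
structure IsBumpSequence (u : ℕ → C(L, ℝ)) (s : ℕ → L) : Prop where
  hasCompactSupport : ∀ j, HasCompactSupport (u j)
  mem_Icc : ∀ j t, u j t ∈ Set.Icc (0 : ℝ) 1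
  apply_eq_one : ∀ j, u j (s j) = 1
  eq_of_ne_zero : ∀ i j t, u i t ≠ 0 → u j t ≠ 0 → i = j

/-- At each point at most one summand is nonzero, and it is at most `‖v - f t‖ ≤ 2`. -/
theorem IsBumpSequence.norm_sum_bumpTowards_le {u : ℕ → C(L, ℝ)} {s : ℕ → L}
    (hu : IsBumpSequence u s) {v : X} {f : C₀(L, X)} (hv : ‖v‖ ≤ 1) (hf : ‖f‖ ≤ 1)
    (F : Finset ℕ) :
    ‖∑ j ∈ F, bumpTowards 𝕜 (u j) (hu.hasCompactSupport j) v f‖ ≤ 2 := by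
  refine norm_le_of_forall_apply_le _ zero_le_two fun t => ?_
  have hft := (norm_apply_le_norm f t).trans hf
  rw [sum_apply]
  simp only [bumpTowards_apply]
  by_cases h : ∃ i ∈ F, u i t ≠ 0
  · obtain ⟨i, hi, hit⟩ := h
    rw [Finset.sum_eq_single_of_mem i hi fun j _ hji => by
      by_cases hj : u j t = 0
      · simp [hj]
      · exact absurd (hu.eq_of_ne_zero _ _ _ hj hit) hji]
    rw [norm_smul, RCLike.norm_of_nonneg (hu.mem_Icc i t).1]
    have := norm_sub_le v (f t)
    have := norm_nonneg (v - f t)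
    have := (hu.mem_Icc i t).2
    nlinarith
  · push Not at h
    rw [Finset.sum_eq_zero fun i hi => by simp [h i hi]]
    simp

theorem IsBumpSequence.add_bumpTowards_apply {u : ℕ → C(L, ℝ)} {s : ℕ → L}
    (hu : IsBumpSequence u s) (v : X) (f : C₀(L, X)) (j : ℕ) :
    (f + bumpTowards 𝕜 (u j) (hu.hasCompactSupport j) v f) (s j) = v := by
  simp [hu.apply_eq_one j]

/-- A nonempty open set without isolated points is infinite, and an infinite Hausdorff space
contains a sequence of disjoint nonempty open sets; Urysohn's lemma puts a bump in each. -/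
theorem exists_isBumpSequence [LocallyCompactSpace L] [T2Space L]
    (hL : ∀ t : L, ¬ IsOpen ({t} : Set L)) {V : Set L} (hV : IsOpen V) (hne : V.Nonempty) :
    ∃ (u : ℕ → C(L, ℝ)) (s : ℕ → L), IsBumpSequence u s ∧ ∀ j, s j ∈ V := by
  obtain ⟨t₀, ht₀⟩ := hne
  have : NeBot (𝓝[≠] t₀) := ⟨fun h => hL t₀ (isOpen_singleton_iff_punctured_nhds t₀ |>.2 h)⟩
  have : Infinite V := (infinite_of_mem_nhds t₀ (hV.mem_nhds ht₀)).to_subtype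
  obtain ⟨U, hUinf, hUo, hUd⟩ := exists_seq_infinite_isOpen_pairwise_disjoint V
  choose s hs using fun n => (hUinf n).nonempty
  have hUo' : ∀ n, IsOpen (Subtype.val '' U n : Set L) := fun n => hV.isOpenMap_subtype_val _ (hUo n)
  choose u hu1 hu0 huc hu01 using fun n => exists_continuous_one_zero_of_isCompact
    (isCompact_singleton (x := (s n : L))) (hUo' n).isClosed_compl
    (by
      rw [Set.disjoint_singleton_left, Set.notMem_compl_iff]
      exact ⟨_, hs n, rfl⟩)
  have hmem : ∀ n t, u n t ≠ 0 → t ∈ (Subtype.val '' U n : Set L) := fun n t h => by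
    by_contra hn
    exact h (hu0 n hn)
  refine ⟨u, fun n => s n, ⟨huc, hu01, fun n => hu1 n rfl, fun i j t hi hj => ?_⟩,
    fun n => (s n).2⟩
  obtain ⟨a, ha, rfl⟩ := hmem i t hi
  obtain ⟨b, hb, hab⟩ := hmem j _ hj
  rw [Subtype.val_injective hab] at hb
  by_contra hij
  exact Set.disjoint_left.1 (hUd hij) ha hb

theorem exists_isOpen_le_norm_sub (𝕂 : Type*) [RCLike 𝕂] [NormedSpace 𝕂 X] [Nonempty L] {f : C₀(L, X)} (hf : ‖f‖ = 1) {ε : ℝ}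
    (hε : 0 < ε) :
    ∃ (v : X) (V : Set L), ‖v‖ ≤ 1 ∧ IsOpen V ∧ V.Nonempty ∧ ∀ t ∈ V, 2 - ε < ‖f t - v‖ := by
  obtain ⟨t₀, ht₀⟩ := exists_lt_norm_apply f (c := 1 - ε / 2) (by linarith)
  have hcont := f.continuous
  refine ⟨-f t₀, {t | 2 - ε < ‖f t - -f t₀‖}, ?_, isOpen_lt continuous_const (by fun_prop),
    ⟨t₀, ?_⟩, fun t ht => ht⟩
  · rw [norm_neg]
    exact (norm_apply_le_norm f t₀).trans hf.le
  · have : ‖f t₀ - -f t₀‖ = 2 * ‖f t₀‖ := by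
      rw [sub_neg_eq_add, ← two_nsmul, ← Nat.cast_smul_eq_nsmul 𝕂, norm_smul]
      simp
    rw [Set.mem_ofPred_eq, this]
    linarith

/-! ### Spaces without isolated points have all the properties. -/

section NoIsolatedPoints

variable [LocallyCompactSpace L] [T2Space L]

theorem dd2p_of_forall_not_isOpen_singleton [Nonempty L]
    (hL : ∀ t : L, ¬ IsOpen ({t} : Set L)) :
    DD2P 𝕜 C₀(L, X) := by
  rintro W - hW f ⟨hfW, hf⟩
  have hf1 : ‖f‖ = 1 := by simpa using hf
  have hWball : ∀ g ∈ W, ‖g‖ ≤ 1 := by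
    obtain ⟨U, -, rfl⟩ := hW
    exact fun g hg => by simpa using hg.1
  refine supDistEqTwo_of_forall_exists hf1.le hWball fun ε hε => ?_
  obtain ⟨v, V, hv, hV, hne, hVf⟩ := exists_isOpen_le_norm_sub 𝕜 hf1 hε
  obtain ⟨u, s, hu, hs⟩ := exists_isBumpSequence hL hV hne
  obtain ⟨j, hj⟩ := (hW.eventually_mem hfW (hu.norm_sum_bumpTowards_le hv hf1.le) fun j =>
    norm_add_bumpTowards_le (𝕜 := 𝕜) _ (hu.mem_Icc j) hv hf1.le).exists
  refine ⟨_, hj, (hVf _ (hs j)).le.trans ?_⟩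
  refine le_of_eq_of_le ?_ (norm_apply_le_norm _ (s j))
  rw [ZeroAtInftyContinuousMap.sub_apply, hu.add_bumpTowards_apply]

theorem restrictedDSD2P_of_forall_not_isOpen_singleton [Nonempty L]
    (hL : ∀ t : L, ¬ IsOpen ({t} : Set L)) :
    RestrictedDSD2P 𝕜 C₀(L, X) := by
  rintro C ⟨n, c, S, hc, hsum, hS, rfl⟩ f ⟨⟨-, y, hy, hfy⟩, hf⟩
  have hf1 : ‖f‖ = 1 := by simpa using hf
  refine supDistEqTwo_of_forall_exists hf1.le (fun g hg => by simpa using hg.1) fun ε hε => ?_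
  obtain ⟨v, V, hv, hV, hne, hVf⟩ := exists_isOpen_le_norm_sub 𝕜 hf1 hε
  obtain ⟨u, s, hu, hs⟩ := exists_isBumpSequence hL hV hne
  have hy1 : ∀ i, ‖y i‖ ≤ 1 := fun i => by
    obtain ⟨φ, δ, -, -, hSi⟩ := hS i
    simpa using (hSi ▸ hy i).1
  have hz1 : ∀ i j, ‖y i + bumpTowards 𝕜 (u j) (hu.hasCompactSupport j) v (y i)‖ ≤ 1 :=
    fun i j => norm_add_bumpTowards_le _ (hu.mem_Icc j) hv (hy1 i)
  -- One bump serves all summands: each stays in its slice and equals `v` at `s j`, hence so does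
  -- their convex combination at that point.
  obtain ⟨j, hj⟩ := (eventually_all.2 fun i => (hS i).isWeaklyOpenInBall.eventually_mem (hy i)
    (hu.norm_sum_bumpTowards_le hv (hy1 i)) (hz1 i)).exists
  refine ⟨∑ i, (c i : 𝕜) • (y i + bumpTowards 𝕜 (u j) (hu.hasCompactSupport j) v (y i)),
    ⟨?_, _, hj, rfl⟩, (hVf _ (hs j)).le.trans ?_⟩
  · rw [mem_closedBall_zero_iff, ← hsum]
    refine norm_sum_le_of_le _ fun i _ => ?_
    rw [norm_smul, RCLike.norm_of_nonneg (hc i).le]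
    exact mul_le_of_le_one_right (hc i).le (hz1 i j)
  · refine le_of_eq_of_le ?_ (norm_apply_le_norm _ (s j))
    rw [ZeroAtInftyContinuousMap.sub_apply, sum_apply]
    simp only [ZeroAtInftyContinuousMap.smul_apply, hu.add_bumpTowards_apply]
    rw [← Finset.sum_smul, ← RCLike.ofReal_sum, hsum, RCLike.ofReal_one, one_smul]

/-- For a weakly compact polynomial `P` on `C₀(L, X)`, the value of `P f` at a point can nearly be
kept in the direction of a functional while prescribing the value of the argument there. -/
theorem exists_apply_eq_and_le_re (hL : ∀ t : L, ¬ IsOpen ({t} : Set L))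
    {P : C₀(L, X) → C₀(L, X)} (hP : IsContinuousPolynomial 𝕜 P) (hPw : IsWeaklyCompactMap 𝕜 P)
    (φ : StrongDual 𝕜 X) {v : X} (hv : ‖v‖ ≤ 1) {f₀ : C₀(L, X)} (hf₀ : ‖f₀‖ ≤ 1) {t₀ : L}
    {a b : ℝ} (hab : a < b) (hb : b < RCLike.re (φ (P f₀ t₀))) :
    ∃ (g : C₀(L, X)) (t : L), ‖g‖ ≤ 1 ∧ g t = v ∧ a ≤ RCLike.re (φ (P g t)) := by
  classical
  by_contra! hcon
  set q : C₀(L, X) → L → ℝ := fun g t => RCLike.re (φ (g t)) with hq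
  have hqc : ∀ g, Continuous (q g) := fun g =>
    RCLike.continuous_re.comp (φ.continuous.comp g.continuous)
  obtain ⟨K, hK, hKt₀⟩ := exists_compact_mem_nhds t₀
  -- A state holds a function, a neighbourhood of `t₀` where its image under `P` is above `b`, and a
  -- finite set of past points where it is below `a`.
  let Good : C₀(L, X) × Set L × Finset L → Prop := fun σ => ‖σ.1‖ ≤ 1 ∧ IsOpen σ.2.1 ∧
    t₀ ∈ σ.2.1 ∧ σ.2.1 ⊆ K ∧ (∀ t ∈ σ.2.1, b < q (P σ.1) t) ∧ ∀ t ∈ σ.2.2, q (P σ.1) t < a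
  have hstep : ∀ σ : {σ // Good σ}, ∃ τ : {σ // Good σ}, τ.1.2.1 ⊆ σ.1.2.1 ∧
      σ.1.2.2 ⊆ τ.1.2.2 ∧ ∃ t ∈ τ.1.2.2, t ∈ σ.1.2.1 := by
    rintro ⟨⟨f, V, T⟩, hf, hV, ht₀, hVK, hbV, haT⟩
    obtain ⟨u, s, hu, hs⟩ := exists_isBumpSequence hL hV ⟨t₀, ht₀⟩
    have hlim : ∀ t, Tendsto
        (fun j => q (P (f + bumpTowards 𝕜 (u j) (hu.hasCompactSupport j) v f)) t) atTop
        (𝓝 (q (P f) t)) := fun t => by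
      simpa using hP.tendsto_re_add (hu.norm_sum_bumpTowards_le hv hf) f (φ.comp (evalAt 𝕜 X t))
    -- For late `j` the perturbation spoils neither the value at `t₀` nor those on `T`. At the new
    -- point `s j` the function equals `v`, so `hcon` puts its image below `a`.
    have h1 := (hlim t₀).eventually (lt_mem_nhds (hbV t₀ ht₀))
    have h2 := (Finset.eventually_all T).2 fun t ht =>
      (hlim t).eventually (gt_mem_nhds (haT t ht))
    obtain ⟨j, hj1, hj2⟩ := (h1.and h2).exists
    set g := f + bumpTowards 𝕜 (u j) (hu.hasCompactSupport j) v f with hg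
    have hg1 : ‖g‖ ≤ 1 := norm_add_bumpTowards_le _ (hu.mem_Icc j) hv hf
    refine ⟨⟨⟨g, V ∩ {t | b < q (P g) t}, insert (s j) T⟩, hg1,
      hV.inter (isOpen_lt continuous_const (hqc _)), ⟨ht₀, hj1⟩, fun t ht => hVK ht.1,
      fun t ht => ht.2, fun t ht => ?_⟩, Set.inter_subset_left, Finset.subset_insert _ _,
      s j, Finset.mem_insert_self _ _, hs j⟩
    rcases Finset.mem_insert.1 ht with rfl | ht
    · exact hcon g _ hg1 (hu.add_bumpTowards_apply v f j)
    · exact hj2 t ht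
  choose next hnextV hnextT pt hptT hptV using hstep
  have hinit : Good (f₀, interior K ∩ {t | b < q (P f₀) t}, ∅) :=
    ⟨hf₀, isOpen_interior.inter (isOpen_lt continuous_const (hqc _)),
      ⟨mem_interior_iff_mem_nhds.2 hKt₀, hb⟩, fun t ht => interior_subset ht.1,
      fun t ht => ht.2, by simp⟩
  let σ : ℕ → {σ // Good σ} := fun n => next^[n] ⟨_, hinit⟩
  have hσ : ∀ n, σ (n + 1) = next (σ n) := fun n => Function.iterate_succ_apply' _ _ _
  have hVanti : Antitone fun n => (σ n).1.2.1 := antitone_nat_of_succ_le fun n => by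
    simp only [hσ]; exact hnextV _
  have hTmono : Monotone fun n => (σ n).1.2.2 := monotone_nat_of_le_succ fun n => by
    simp only [hσ]; exact hnextT _
  set F : ℕ → C₀(L, X) := fun n => (σ n).1.1
  set t : ℕ → L := fun n => pt (σ n)
  -- The array is below `a` on one side of the diagonal and above `b` on the other, so the two
  -- iterated limits disagree.
  have hFa : ∀ m n, m < n → q (P (F n)) (t m) < a := fun m n hmn =>
    (σ n).2.2.2.2.2.2 _ (hTmono (Nat.succ_le_of_lt hmn) (by simp only [hσ]; exact hptT _))
  have hFb : ∀ m n, n ≤ m → b < q (P (F n)) (t m) := fun m n hnm =>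
    (σ n).2.2.2.2.2.1 _ (hVanti hnm (hptV _))
  -- Compactness of `K` and weak compactness of `P` supply cluster points `t'` and `y`. Evaluating
  -- `y` at `t'` in the two orders gives both `≤ a` and `≥ b`.
  obtain ⟨t', -, ht'⟩ := hK.exists_mapClusterPt_of_frequently (f := t) (l := atTop)
    (Eventually.of_forall fun n => (σ n).2.2.2.2.1 (hptV _)).frequently
  obtain ⟨w, -, hw⟩ := hPw.exists_mapClusterPt_of_frequently
    (f := fun n => toWeakSpace 𝕜 C₀(L, X) (P (F n))) (l := atTop)
    (Eventually.of_forall fun n => subset_closure (Set.mem_image_of_mem _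
      (Set.mem_image_of_mem P (by simpa using (σ n).2.1)))).frequently
  set y : C₀(L, X) := (toWeakSpace 𝕜 C₀(L, X)).symm w with hy
  have hclw : ∀ s, MapClusterPt (q y s) atTop fun n => q (P (F n)) s := fun s =>
    hw.continuousAt_comp (f := fun w => RCLike.re ((φ.comp (evalAt 𝕜 X s))
      ((toWeakSpace 𝕜 C₀(L, X)).symm w))) (continuous_re_weakSpace _).continuousAt
  have hya : q y t' ≤ a := by
    refine isClosed_Iic.mem_of_mapClusterPt (ht'.continuousAt_comp (hqc y).continuousAt)
      (Eventually.of_forall fun m => ?_)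
    exact isClosed_Iic.mem_of_mapClusterPt (hclw (t m))
      ((eventually_gt_atTop m).mono fun n hn => (hFa m n hn).le)
  have hyb : b ≤ q y t' := by
    refine isClosed_Ici.mem_of_mapClusterPt (hclw t') (Eventually.of_forall fun n => ?_)
    exact isClosed_Ici.mem_of_mapClusterPt (ht'.continuousAt_comp (hqc (P (F n))).continuousAt)
      ((eventually_ge_atTop n).mono fun m hm => (hFb m n hm).le)
  linarith

theorem polynomialDaugavetProperty_of_forall_not_isOpen_singleton [Nonempty L] [Nontrivial X]
    (hL : ∀ t : L, ¬ IsOpen ({t} : Set L)) : PolynomialDaugavetProperty 𝕜 C₀(L, X) := by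
  intro P hP hPw
  have hPb := hP.bddAbove
  have h0 : (0 : C₀(L, X)) ∈ Metric.closedBall (0 : C₀(L, X)) 1 := by simp
  have hub : 1 + ballSupNorm P ∈
      upperBounds ((fun f => ‖f + P f‖) '' Metric.closedBall (0 : C₀(L, X)) 1) := by
    rintro _ ⟨f, hf, rfl⟩
    exact (norm_add_le _ _).trans
      (add_le_add (by simpa using hf) (le_csSup hPb ⟨f, hf, rfl⟩))
  refine le_antisymm (csSup_le ⟨_, 0, h0, rfl⟩ hub) (le_of_forall_pos_sub_le fun ε hε => ?_)
  obtain ⟨_, ⟨f, hf, rfl⟩, hfP⟩ := exists_lt_of_lt_csSup (⟨_, 0, h0, rfl⟩ :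
    ((fun f => ‖P f‖) '' Metric.closedBall (0 : C₀(L, X)) 1).Nonempty)
    (sub_lt_self (ballSupNorm P) (show 0 < ε / 4 by positivity))
  obtain ⟨t₀, ht₀⟩ := exists_lt_norm_apply (P f) hfP
  -- With `g t = v`, both summands of `φ (g t + P g t)` have large real part: exactly 1, and at
  -- least `ballSupNorm P - ε / 2`.
  obtain ⟨φ, v, hφ, hv, hφv, hφP⟩ := exists_dual_vector_and_peak 𝕜 (P f t₀)
  obtain ⟨g, t, hg, hgt, hga⟩ := exists_apply_eq_and_le_re hL hP hPw φ hv.le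
    (by simpa using hf) (a := ballSupNorm P - ε / 2) (b := ballSupNorm P - ε / 4) (t₀ := t₀)
    (by linarith) (by rw [hφP, RCLike.ofReal_re]; exact ht₀)
  refine le_trans ?_ (le_csSup ⟨_, hub⟩ ⟨g, by simpa using hg, rfl⟩)
  refine le_trans ?_ (norm_apply_le_norm _ t)
  have h1 : ‖φ ((g + P g) t)‖ ≤ ‖(g + P g) t‖ := by simpa [hφ] using φ.le_opNorm ((g + P g) t)
  have h2 := RCLike.re_le_norm (φ ((g + P g) t))
  rw [ZeroAtInftyContinuousMap.add_apply, hgt, map_add, map_add, hφv, RCLike.one_re] at h2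
  rw [ZeroAtInftyContinuousMap.add_apply, hgt] at h1 ⊢
  rw [map_add, hφv] at h1
  linarith

end NoIsolatedPoints

end ZeroAtInfty

/-! ### Rotundity and isolated points. -/

/-- In a locally uniformly rotund space `‖I - φ ⊗ x‖ < 2` for a norming pair `(φ, x)`. -/
theorem IsLUR.exists_norm_sub_smul_le {𝕜 X : Type*} [RCLike 𝕜] [NormedAddCommGroup X]
    [NormedSpace 𝕜 X] (hX : IsLUR 𝕜 X) {φ : StrongDual 𝕜 X} {x : X} (hφ : ‖φ‖ = 1) (hx : ‖x‖ = 1)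
    (hφx : φ x = 1) : ∃ c < (2 : ℝ), ∀ v : X, ‖v‖ ≤ 1 → ‖v - φ v • x‖ ≤ c := by
  by_contra! hcon
  have hφle : ∀ v : X, ‖φ v‖ ≤ ‖v‖ := fun v => by simpa [hφ] using φ.le_opNorm v
  -- Multiplying by a scalar of modulus one makes `φ w` real and nonnegative, so that `φ (w + x)`
  -- can bound `‖w + x‖` from below.
  have hex : ∀ k : ℕ, ∃ w : X, ‖w‖ ≤ 1 ∧ φ w = (‖φ w‖ : 𝕜) ∧
      2 - 1 / ((k : ℝ) + 1) < ‖w - φ w • x‖ := by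
    intro k
    obtain ⟨v, hv, hvk⟩ := hcon (2 - 1 / ((k : ℝ) + 1)) (sub_lt_self _ (by positivity))
    obtain ⟨c, hc, hcv⟩ : ∃ c : 𝕜, ‖c‖ = 1 ∧ c * φ v = (‖φ v‖ : 𝕜) := by
      obtain ⟨c, hc, h⟩ := RCLike.exists_norm_eq_mul_self (φ v)
      exact ⟨c, hc, h.symm⟩
    refine ⟨c • v, by simpa [norm_smul, hc] using hv, ?_, ?_⟩
    · simp [hcv]
    · rwa [map_smul, smul_assoc, ← smul_sub, norm_smul, hc, one_mul]
  choose u hu1 huφ hu2 using hex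
  have hφu : ∀ k, ‖φ (u k)‖ ≤ 1 := fun k => (hφle _).trans (hu1 k)
  have hlow : ∀ k : ℕ, 2 - 1 / ((k : ℝ) + 1) ≤ ‖u k‖ + ‖φ (u k)‖ := fun k => by
    refine (hu2 k).le.trans ((norm_sub_le _ _).trans ?_)
    rw [norm_smul, hx, mul_one]
  have hlim : Tendsto (fun k : ℕ => 1 - 1 / ((k : ℝ) + 1)) atTop (𝓝 1) := by
    simpa using tendsto_const_nhds.sub (tendsto_one_div_add_atTop_nhds_zero_nat (𝕜 := ℝ))
  have hnorm : Tendsto (fun k => ‖u k‖) atTop (𝓝 1) :=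
    tendsto_of_tendsto_of_tendsto_of_le_of_le hlim tendsto_const_nhds
      (fun k => by linarith [hlow k, hφu k]) hu1
  have hφlim : Tendsto (fun k => ‖φ (u k)‖) atTop (𝓝 1) :=
    tendsto_of_tendsto_of_tendsto_of_le_of_le hlim tendsto_const_nhds
      (fun k => by linarith [hlow k, hu1 k]) hφu
  have hmid : Tendsto (fun k => ‖(2⁻¹ : 𝕜) • (u k + x)‖) atTop (𝓝 1) := by
    have h1 : Tendsto (fun k => 2⁻¹ * (‖φ (u k)‖ + 1)) atTop (𝓝 1) := by
      have := (hφlim.add_const 1).const_mul 2⁻¹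
      norm_num at this ⊢
      exact this
    refine tendsto_of_tendsto_of_tendsto_of_le_of_le h1 tendsto_const_nhds (fun k => ?_)
      fun k => ?_
    · have h2 : φ (u k + x) = ((‖φ (u k)‖ + 1 : ℝ) : 𝕜) := by
        rw [map_add, hφx, huφ k]
        simp
      have h3 := hφle (u k + x)
      rw [h2, RCLike.norm_of_nonneg (by positivity)] at h3
      rw [norm_smul, norm_inv, RCLike.norm_ofNat]
      linarith
    · rw [norm_smul, norm_inv, RCLike.norm_ofNat]
      have := norm_add_le (u k) x
      linarith [hu1 k]
  -- Rotundity forces `u k → x`, hence `u k - φ (u k) • x → x - x = 0`, against norms tending to 2.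
  have hux := hX x u (by rwa [hx]) (by rwa [hx])
  have hzero : Tendsto (fun k => ‖u k - φ (u k) • x‖) atTop (𝓝 0) := by
    have hu : Tendsto u atTop (𝓝 x) := tendsto_iff_norm_sub_tendsto_zero.2 hux
    have := (hu.sub (((φ.continuous.tendsto x).comp hu).smul_const x)).norm
    simpa [hφx] using this
  have h1 := hzero.eventually (gt_mem_nhds one_pos)
  obtain ⟨k, hk⟩ := h1.exists
  have h2 := hu2 k
  have h3 : 1 / ((k : ℝ) + 1) ≤ 1 := div_le_one_of_le₀ (by linarith [k.cast_nonneg (α := ℝ)])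
    (by positivity)
  linarith

section IsolatedPoint

variable {L X : Type*} [TopologicalSpace L] [T2Space L] [NormedAddCommGroup X]

open Classical in
/-- The function supported at an isolated point `t` with value `v` there. -/
def isolatedSingle {t : L} (ht : IsOpen ({t} : Set L)) (v : X) : C₀(L, X) where
  toFun s := if s = t then v else 0
  continuous_toFun :=
    continuous_if (fun a ha => by
      have hcl : IsClopen {s : L | s = t} := ⟨isClosed_singleton, ht⟩
      rw [hcl.frontier_eq] at ha
      exact ha.elim) continuousOn_const continuousOn_const
  zero_at_infty' := by
    refine HasCompactSupport.is_zero_at_infty (f := fun s => if s = t then v else 0) ?_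
    refine HasCompactSupport.intro (isCompact_singleton (x := t)) fun s hs => ?_
    exact if_neg hs

theorem isolatedSingle_self {t : L} (ht : IsOpen ({t} : Set L)) (v : X) :
    isolatedSingle ht v t = v := if_pos rfl

theorem isolatedSingle_of_ne {t s : L} (ht : IsOpen ({t} : Set L)) (v : X) (hs : s ≠ t) :
    isolatedSingle ht v s = 0 := if_neg hs

theorem norm_isolatedSingle {t : L} (ht : IsOpen ({t} : Set L)) (v : X) :
    ‖isolatedSingle ht v‖ = ‖v‖ := by
  refine le_antisymm (norm_le_of_forall_apply_le _ (norm_nonneg v) fun s => ?_) ?_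
  · by_cases hs : s = t
    · rw [hs, isolatedSingle_self]
    · simp [isolatedSingle_of_ne ht v hs]
  · conv_lhs => rw [← isolatedSingle_self ht v]
    exact norm_apply_le_norm _ t

theorem PropertyD.not_isOpen_singleton {𝕜 : Type*} [RCLike 𝕜] [NormedSpace 𝕜 X] [Nontrivial X]
    (hX : IsLUR 𝕜 X) (hD : PropertyD 𝕜 C₀(L, X)) (t : L) : ¬ IsOpen ({t} : Set L) := by
  intro ht
  obtain ⟨φ, x, hφ, hx, hφx, -⟩ := exists_dual_vector_and_peak 𝕜 (0 : X)
  obtain ⟨c, hc, hcv⟩ := hX.exists_norm_sub_smul_le hφ hx hφx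
  set e : C₀(L, X) := isolatedSingle ht x with he
  have het : e t = x := isolatedSingle_self ht x
  have he1 : ‖e‖ = 1 := (norm_isolatedSingle ht x).trans hx
  have he0 : e ≠ 0 := norm_ne_zero_iff.1 (by rw [he1]; exact one_ne_zero)
  set ψ : StrongDual 𝕜 C₀(L, X) := φ.comp (evalAt 𝕜 X t) with hψ
  have hψe : ψ e = 1 := by simp [hψ, het, hφx]
  have hψle : ∀ f, ‖ψ f‖ ≤ ‖f‖ := fun f =>
    (φ.le_of_opNorm_le hφ.le (f t)).trans (by simpa using norm_apply_le_norm f t)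
  set P : C₀(L, X) →L[𝕜] C₀(L, X) := ψ.smulRight e with hP
  have hPf : ∀ f, P f = ψ f • e := fun f => rfl
  have hPe : P e = e := by rw [hPf, hψe, one_smul]
  have hnorm : ‖P‖ = 1 := by
    refine le_antisymm (P.opNorm_le_bound zero_le_one fun f => ?_) ?_
    · rw [hPf, norm_smul, he1, mul_one, one_mul]
      exact hψle f
    · simpa [hPe, he1] using P.le_opNorm e
  have hrank : LinearMap.rank (P : C₀(L, X) →ₗ[𝕜] C₀(L, X)) = 1 := by
    refine (rank_submodule_eq_one_iff _).2 ⟨e, ⟨e, hPe⟩, he0, ?_⟩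
    rintro _ ⟨f, rfl⟩
    exact Submodule.mem_span_singleton.2 ⟨ψ f, rfl⟩
  have h2 := hD P (by ext1 f; simp [hPf, hψe]) hrank hnorm
  -- Away from `t` the operator leaves values unchanged; at `t` it acts as `v ↦ v - φ v • x`,
  -- bounded by `c < 2`.
  have hle : ‖ContinuousLinearMap.id 𝕜 C₀(L, X) - P‖ ≤ max 1 c := by
    refine ContinuousLinearMap.opNorm_le_of_unit_norm (by positivity) fun f hf => ?_
    refine norm_le_of_forall_apply_le _ (by positivity) fun s => ?_
    have hfs := (norm_apply_le_norm f s).trans hf.le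
    have hval : (ContinuousLinearMap.id 𝕜 C₀(L, X) - P) f s = f s - φ (f t) • e s := rfl
    rw [hval]
    by_cases hs : s = t
    · subst hs
      rw [het]
      exact (hcv _ hfs).trans (le_max_right _ _)
    · rw [he, isolatedSingle_of_ne ht x hs, smul_zero, sub_zero]
      exact hfs.trans (le_max_left _ _)
  rw [h2] at hle
  exact absurd hle (not_le.2 (max_lt one_lt_two hc))

end IsolatedPoint
end DaugavetNotions

end

theorem mainTheorem3 {𝕜 : Type*} [RCLike 𝕜]
    {L : Type*} [TopologicalSpace L] [LocallyCompactSpace L] [T2Space L] [Nonempty L]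
    {X : Type*} [NormedAddCommGroup X] [NormedSpace 𝕜 X] [CompleteSpace X] [Nontrivial X]
    (hX : DaugavetNotions.IsLUR 𝕜 X) :
    List.TFAE [
      DaugavetNotions.PolynomialDaugavetProperty 𝕜 C₀(L, X),
      DaugavetNotions.DaugavetProperty 𝕜 C₀(L, X),
      DaugavetNotions.RestrictedDSD2P 𝕜 C₀(L, X),
      DaugavetNotions.DD2P 𝕜 C₀(L, X),
      DaugavetNotions.DLD2P 𝕜 C₀(L, X),
      DaugavetNotions.PropertyD 𝕜 C₀(L, X),
      ∀ t : L, ¬ IsOpen ({t} : Set L)] := by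
  tfae_have 1 → 2 := fun h => h.daugavetProperty
  tfae_have 2 → 6 := fun h => h.propertyD
  tfae_have 3 → 5 := fun h => h.dld2p
  tfae_have 4 → 5 := fun h => h.dld2p
  tfae_have 5 → 6 := fun h => h.propertyD
  tfae_have 6 → 7 := fun h => h.not_isOpen_singleton hX
  tfae_have 7 → 1 := fun h =>
    DaugavetNotions.polynomialDaugavetProperty_of_forall_not_isOpen_singleton h
  tfae_have 7 → 3 := fun h => DaugavetNotions.restrictedDSD2P_of_forall_not_isOpen_singleton h
  tfae_have 7 → 4 := fun h => DaugavetNotions.dd2p_of_forall_not_isOpen_singleton h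
  tfae_finish
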